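/- Let $n\ge 2$ be an integer, let $r>1$ be real, and let $f(x)=x_1x_2\cdots x_n$ on the box $B=[1,r]^n$. Let $\operatorname{vex}_B f$ be the convex envelope of $f$ over $B$ (the pointwise supremum of all convex functions on $B$ that underestimate $f$ on $B$), and let $\operatorname{cav}_B f$ be the concave envelope (the pointwise infimum of all concave functions on $B$ that overestimate $f$ on $B$). For a function $g$ on $B$ let $\mathcal G(g)=\{(x,g(x)) : x\in B\}$ be its graph, and for a set $X\subseteq B\times\mathbb R$ define its error by $\operatorname{err}(X)=\max_{(x,w)\in X}|w-f(x)|$. Put $$D_{r,n}=\max_{i=1,\dots,n-1}\left\{\Bigl(1+\tfrac{i}{n}(r-1)\Bigr)^n-r^i\right\},\qquad E_{r,n}=1+\frac{r^n-1}{r-1}\left[\frac{n-1}{n}\left(\frac{r^n-1}{n(r-1)}\right)^{\frac1{n-1}}-1\right].$$ Then all three of the following maxima exist, and $$\operatorname{err}\bigl(\mathcal G(\operatorname{cav}_B f)\bigr)=E_{r,n},\qquad \operatorname{err}\bigl(\mathcal G(\operatorname{vex}_B f)\bigr)=D_{r,n},\qquad \operatorname{err}\bigl(\operatorname{conv}\mathcal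 G(f)\bigr)=\max\{D_{r,n},E_{r,n}\}.$$ Moreover, each of the three maxima is attained only on the relative interior of the segment joining $\mathbf 1=(1,\dots,1)$ and $r\mathbf 1=(r,\dots,r)$: every maximizing point $(x,w)$ has $x=t\mathbf 1$ for some $1<t<r$. -/

import Mathlib

/-- The multilinear monomial `x₁ x₂ ⋯ xₙ`. -/
def multilinearMonomial (n : ℕ) (x : Fin n → ℝ) : ℝ := ∏ j, x j

/-- The box `[1, r]ⁿ`. -/
def oneBox (r : ℝ) (n : ℕ) : Set (Fin n → ℝ) := Set.Icc (fun _ => 1) (fun _ => r)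

/-- Convex envelope of `f` over `S`: the pointwise supremum of all convex functions on `S` that
underestimate `f` on `S`. -/
noncomputable def convexEnvelope {n : ℕ} (f : (Fin n → ℝ) → ℝ) (S : Set (Fin n → ℝ))
    (x : Fin n → ℝ) : ℝ :=
  sSup {v | ∃ g : (Fin n → ℝ) → ℝ, ConvexOn ℝ S g ∧ (∀ y ∈ S, g y ≤ f y) ∧ g x = v}

/-- Concave envelope of `f` over `S`: the pointwise infimum of all concave functions on `S` that
overestimate `f` on `S`. -/
noncomputable def concaveEnvelope {n : ℕ} (f : (Fin n → ℝ) → ℝ) (S : Set (Fin n → ℝ))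
    (x : Fin n → ℝ) : ℝ :=
  sInf {v | ∃ g : (Fin n → ℝ) → ℝ, ConcaveOn ℝ S g ∧ (∀ y ∈ S, f y ≤ g y) ∧ g x = v}

/-- The absolute deviation `|w - f x|` at a point `(x, w)`. -/
def deviation {n : ℕ} (f : (Fin n → ℝ) → ℝ) (p : (Fin n → ℝ) × ℝ) : ℝ := |p.2 - f p.1|

/-- `e` is the error of `X` with respect to `f`: the maximum (which is attained) of `|w - f x|`
over `(x, w) ∈ X`. -/
def IsError {n : ℕ} (f : (Fin n → ℝ) → ℝ) (X : Set ((Fin n → ℝ) × ℝ)) (e : ℝ) : Prop :=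
  IsGreatest (deviation f '' X) e

/-- The error value `e` is attained in `X` only at points `(x, w)` with `x ∈ T`. -/
def AttainedOnlyOn {n : ℕ} (f : (Fin n → ℝ) → ℝ) (X : Set ((Fin n → ℝ) × ℝ)) (e : ℝ)
    (T : Set (Fin n → ℝ)) : Prop :=
  ∀ p ∈ X, deviation f p = e → p.1 ∈ T

/-- The relative interior of the convex hull of `X`. -/
def relintHull {n : ℕ} (X : Set (Fin n → ℝ)) : Set (Fin n → ℝ) :=
  intrinsicInterior ℝ (convexHull ℝ X)

/-- The constant `D_{r,n} = max_{i = 1, …, n-1} ((1 + (i/n)(r-1))ⁿ - rⁱ)`, for `n ≥ 2`. -/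
noncomputable def constD (r : ℝ) (n : ℕ) (hn : 2 ≤ n) : ℝ :=
  (Finset.Icc 1 (n - 1)).sup' (Finset.nonempty_Icc.mpr (Nat.le_sub_one_of_lt hn))
    (fun i => (1 + (i : ℝ) / (n : ℝ) * (r - 1)) ^ n - r ^ i)

/-- The constant
`E_{r,n} = 1 + (rⁿ-1)/(r-1) * [(n-1)/n * ((rⁿ-1)/(n(r-1)))^(1/(n-1)) - 1]`. -/
noncomputable def constE (r : ℝ) (n : ℕ) : ℝ :=
  1 + (r ^ n - 1) / (r - 1) *
    (((n : ℝ) - 1) / (n : ℝ) *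
      ((r ^ n - 1) / ((n : ℝ) * (r - 1))) ^ (1 / ((n : ℝ) - 1)) - 1)

/-!
Write `f x = ∏ xᵢ` and `S = 1 + r + ⋯ + rⁿ⁻¹`. The envelopes of `f` over the box are never computed
in closed form; only the linear bounds that control the errors are needed.

*Above.* For each permutation `σ`, the affine function `1 + ∑ rⁱ (x (σ i) - 1)` overestimates `f`
on the box (`prod_le_one_add_sum_pow_mul`), hence bounds the concave envelope. Let `σ` sort `x` in
decreasing order. For a fixed value `tⁿ` of the product, the bound is then largest when all
coordinates equal `t` (`sum_pow_mul_le_of_antitone`, through Chebyshev's sum inequality), so the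
error is at most `1 + S (t - 1) - tⁿ`, whose maximum over `t` is `E` (`constE_isMax`). The chord of
the graph from `𝟏` to `r𝟏` attains it.

*Below.* For each natural number `k`, the affine function `rᵏ (1 + ∑ (xᵢ - 1) - k (r - 1))`
underestimates `f` (`pow_mul_one_add_sum_sub_le_prod`). For a fixed coordinate sum, `f` is largest
at the constant vector, by the inequality of arithmetic and geometric means. In terms of
`s = ∑ (xᵢ - 1) / (r - 1)` the error is then at most `(1 + (s / n) (r - 1))ⁿ` minus the piecewise
linear interpolation of `rˢ` at the integers; this is convex between consecutive integers, so its
maximum is at an integer, and is `D` (`prod_sub_le_constD`). At `s = k`, the diagonal point is the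
average of the cyclic shifts of a vertex with `k` coordinates equal to `r`, all of height `rᵏ`,
which shows that the bound is attained (`exists_mem_hull_sub_eq_constD`).

Both symmetrisation inequalities are strict off the diagonal, and the errors vanish at `𝟏` and
`r𝟏` while `D` and `E` are positive; this locates the maximizers. A point of the convex hull of the
graph lies between the two envelopes, which settles the hull.
-/

/-! ### Linear bounds on a product over the box -/

/-- Telescoping the product gives `∏ xᵢ - 1 = ∑ (∏_{j<i} xⱼ) (xᵢ - 1)`, and each partial product is
at most `r ^ i`. -/
theorem prod_le_one_add_sum_pow_mul {r : ℝ} (hr : 1 ≤ r) :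
    ∀ (n : ℕ) (x : Fin n → ℝ), (∀ i, x i ∈ Set.Icc 1 r) →
      ∏ i, x i ≤ 1 + ∑ i : Fin n, r ^ (i : ℕ) * (x i - 1)
  | 0, _, _ => by simp
  | n + 1, x, hx => by
    have ih := prod_le_one_add_sum_pow_mul hr n (fun i => x i.castSucc) fun i => hx _
    have hP : ∏ i : Fin n, x i.castSucc ≤ r ^ n := by
      calc ∏ i : Fin n, x i.castSucc ≤ ∏ _i : Fin n, r :=
            Finset.prod_le_prod (fun i _ => by linarith [(hx i.castSucc).1])
              fun i _ => (hx i.castSucc).2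
        _ = r ^ n := by simp
    rw [Fin.prod_univ_castSucc, Fin.sum_univ_castSucc]
    simp only [Fin.val_castSucc, Fin.val_last]
    have hl := (hx (Fin.last n)).1
    nlinarith [mul_le_mul_of_nonneg_right hP (sub_nonneg.2 hl)]

/-- Both sides are affine in each coordinate, so an induction over the coordinates reduces the
bound to the Bernoulli inequality `1 ≥ r ^ k (1 - k (r - 1))`. -/
theorem pow_mul_one_add_sum_sub_le_prod {ι : Type*} {r : ℝ} (hr : 1 ≤ r) {x : ι → ℝ}
    (hx : ∀ i, x i ∈ Set.Icc 1 r) (s : Finset ι) (k : ℕ) :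
    r ^ k * (1 + ∑ i ∈ s, (x i - 1) - k * (r - 1)) ≤ ∏ i ∈ s, x i := by
  classical
  induction s using Finset.induction_on generalizing k with
  | empty =>
    simp only [Finset.sum_empty, Finset.prod_empty, add_zero]
    induction k with
    | zero => simp
    | succ k ih =>
      have hk : (0 : ℝ) ≤ k := k.cast_nonneg
      have h1 : (0 : ℝ) ≤ r ^ k := by positivity
      have h2 : r * (1 - ((k : ℝ) + 1) * (r - 1)) ≤ 1 - k * (r - 1) := by
        nlinarith [mul_nonneg (mul_nonneg hk (sub_nonneg.2 hr)) (sub_nonneg.2 hr),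
          sq_nonneg (r - 1)]
      calc r ^ (k + 1) * (1 - ((k + 1 : ℕ) : ℝ) * (r - 1))
          = r ^ k * (r * (1 - ((k : ℝ) + 1) * (r - 1))) := by push_cast; ring
        _ ≤ r ^ k * (1 - k * (r - 1)) := mul_le_mul_of_nonneg_left h2 h1
        _ ≤ 1 := ih
  | insert a s ha ih =>
    rw [Finset.sum_insert ha, Finset.prod_insert ha]
    obtain ⟨h1, h2⟩ := hx a
    have hP : 1 ≤ ∏ i ∈ s, x i := by
      have := Finset.prod_le_prod (s := s) (f := fun _ => (1 : ℝ)) (fun _ _ => zero_le_one)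
        fun i _ => (hx i).1
      simpa using this
    cases k with
    | zero =>
      have := ih 0
      simp only [pow_zero, Nat.cast_zero, zero_mul, sub_zero, one_mul] at this ⊢
      nlinarith
    | succ k =>
      -- interpolate between the endpoints `x a = 1` and `x a = r`
      have e1 := ih (k + 1)
      have e2 := ih k
      push_cast at e1 ⊢
      have hr0 : 0 ≤ r := by linarith
      rcases eq_or_lt_of_le hr with rfl | hr'
      · have : x a = 1 := le_antisymm h2 h1
        rw [this]; simpa using e1
      have e3 := mul_le_mul_of_nonneg_left e2 hr0
      have e4 := mul_le_mul_of_nonneg_left e1 (sub_nonneg.2 h2)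
      have e5 := mul_le_mul_of_nonneg_left e3 (sub_nonneg.2 h1)
      refine le_of_mul_le_mul_left ?_ (sub_pos.2 hr')
      rw [pow_succ] at *
      linarith

/-! ### Symmetrisation inequalities -/

/-- The strict inequality of arithmetic and geometric means. -/
theorem prod_le_pow_of_sum_eq {n : ℕ} {x : Fin n → ℝ} {a : ℝ} (ha : 0 < a) (hx : ∀ i, 0 < x i)
    (hs : ∑ i, x i = n * a) : ∏ i, x i ≤ a ^ n ∧ (∏ i, x i = a ^ n → ∀ i, x i = a) := by
  have hq : ∀ i, 0 < x i / a := fun i => div_pos (hx i) ha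
  have hle : ∀ i, Real.log (x i / a) ≤ x i / a - 1 := fun i => Real.log_le_sub_one_of_pos (hq i)
  have hsum : ∑ i, (x i / a - 1) = 0 := by
    rw [Finset.sum_sub_distrib, ← Finset.sum_div, hs]; simp [ha.ne']
  have hlog : Real.log (∏ i, x i / a) = ∑ i, Real.log (x i / a) :=
    Real.log_prod fun i _ => (hq i).ne'
  have hprod : ∏ i, x i / a = (∏ i, x i) / a ^ n := by simp [Finset.prod_div_distrib]
  have hpos : 0 < ∏ i, x i / a := Finset.prod_pos fun i _ => hq i
  constructor
  · have h0 : Real.log (∏ i, x i / a) ≤ 0 := by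
      rw [hlog, ← hsum]; exact Finset.sum_le_sum fun i _ => hle i
    rwa [Real.log_nonpos_iff hpos.le, hprod, div_le_one (by positivity)] at h0
  · intro h i
    by_contra hne
    have h1 : x i / a ≠ 1 := fun h => hne ((div_eq_one_iff_eq ha.ne').1 h)
    have : ∑ i, Real.log (x i / a) < ∑ i, (x i / a - 1) :=
      Finset.sum_lt_sum (fun i _ => hle i)
        ⟨i, Finset.mem_univ _, Real.log_lt_sub_one_of_pos (hq i) h1⟩
    rw [hsum, ← hlog, hprod, h, div_self (by positivity), Real.log_one] at this
    exact this.false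

/-- Among decreasing vectors in `[1, r]ⁿ` with given geometric mean `t`, the weighted sum
`∑ rⁱ xᵢ` is largest at the constant vector. Indeed `xᵢ - t ≤ xᵢ log (xᵢ / t)`; since the ratio of
two coordinates is at most `r`, the sequence `rⁱ xᵢ` is increasing while `log (xᵢ / t)` is
decreasing with sum zero, and Chebyshev's sum inequality applies. -/
theorem sum_pow_mul_le_of_antitone {n : ℕ} {r t : ℝ} (hr : 1 ≤ r) (ht : 0 < t) {x : Fin n → ℝ}
    (hx : ∀ i, x i ∈ Set.Icc 1 r) (hanti : Antitone x) (hprod : ∏ i, x i = t ^ n) :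
    ∑ i : Fin n, r ^ (i : ℕ) * x i ≤ (∑ i : Fin n, r ^ (i : ℕ)) * t ∧
      (∑ i : Fin n, r ^ (i : ℕ) * x i = (∑ i : Fin n, r ^ (i : ℕ)) * t → ∀ i, x i = t) := by
  have hr0 : 0 < r := by linarith
  have hpos : ∀ i, 0 < x i := fun i => by linarith [(hx i).1]
  have hlogsum : ∑ i, Real.log (x i / t) = 0 := by
    rw [← Real.log_prod fun i _ => (div_pos (hpos i) ht).ne', Finset.prod_div_distrib, hprod]
    simp [ht.ne']
  have hmono : Monotone fun i : Fin n => r ^ (i : ℕ) * x i := by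
    intro i j hij
    rcases hij.eq_or_lt with rfl | hlt
    · exact le_rfl
    calc r ^ (i : ℕ) * x i ≤ r ^ (i : ℕ) * r := by gcongr; exact (hx i).2
      _ = r ^ ((i : ℕ) + 1) := by ring
      _ ≤ r ^ (j : ℕ) := pow_le_pow_right₀ hr hlt
      _ ≤ r ^ (j : ℕ) * x j := le_mul_of_one_le_right (by positivity) (hx j).1
  have hanti' : Antitone fun i : Fin n => Real.log (x i / t) := fun i j hij =>
    Real.log_le_log (div_pos (hpos j) ht) (div_le_div_of_nonneg_right (hanti hij) ht.le)
  have hcheb : ∑ i : Fin n, r ^ (i : ℕ) * x i * Real.log (x i / t) ≤ 0 := by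
    have h := (hmono.antivary hanti').card_mul_sum_le_sum_mul_sum
    rw [hlogsum, mul_zero] at h
    rcases Nat.eq_zero_or_pos n with rfl | hn
    · simp
    · have hn' : (0 : ℝ) < Fintype.card (Fin n) := by simpa using hn
      exact nonpos_of_mul_nonpos_right h hn'
  have hkey : ∀ y, 0 < y → y - t ≤ y * Real.log (y / t) ∧
      (y ≠ t → y - t < y * Real.log (y / t)) := by
    intro y hy
    have e : Real.log (y / t) = - Real.log (t / y) := by rw [← Real.log_inv, inv_div]
    have e2 : y * (t / y) = t := by field_simp
    constructor
    · nlinarith [mul_le_mul_of_nonneg_left (Real.log_le_sub_one_of_pos (div_pos ht hy)) hy.le]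
    · intro hne
      have h1 : t / y ≠ 1 := fun h => hne ((div_eq_one_iff_eq hy.ne').1 h).symm
      nlinarith [mul_lt_mul_of_pos_left (Real.log_lt_sub_one_of_pos (div_pos ht hy) h1) hy]
  have hterm : ∀ i : Fin n, r ^ (i : ℕ) * (x i - t) ≤ r ^ (i : ℕ) * x i * Real.log (x i / t) :=
    fun i => by
      rw [mul_assoc]; exact mul_le_mul_of_nonneg_left (hkey _ (hpos i)).1 (by positivity)
  have hsub : ∑ i : Fin n, r ^ (i : ℕ) * (x i - t)
      = ∑ i : Fin n, r ^ (i : ℕ) * x i - (∑ i : Fin n, r ^ (i : ℕ)) * t := by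
    simp only [mul_sub, Finset.sum_sub_distrib, Finset.sum_mul]
  constructor
  · linarith [Finset.sum_le_sum fun i (_ : i ∈ Finset.univ) => hterm i]
  · intro h i
    by_contra hne
    have : ∑ i : Fin n, r ^ (i : ℕ) * (x i - t)
        < ∑ i : Fin n, r ^ (i : ℕ) * x i * Real.log (x i / t) :=
      Finset.sum_lt_sum (fun i _ => hterm i) ⟨i, Finset.mem_univ _, by
        rw [mul_assoc]
        exact mul_lt_mul_of_pos_left ((hkey _ (hpos i)).2 hne) (by positivity)⟩
    linarith

/-! ### The constant `E` -/

/-- `E` is the maximum over `t ≥ 0` of `1 + S (t - 1) - tⁿ` with `S = 1 + r + ⋯ + rⁿ⁻¹`; the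
maximizer is the critical point `τ` given by `n τⁿ⁻¹ = S`. -/
theorem constE_isMax {n : ℕ} (hn : 2 ≤ n) {r : ℝ} (hr : 1 < r) :
    (∀ t : ℝ, 0 ≤ t → 1 + (∑ i : Fin n, r ^ (i : ℕ)) * (t - 1) - t ^ n ≤ constE r n) ∧
    (∃ τ : ℝ, 1 ≤ τ ∧ τ ≤ r ∧
      1 + (∑ i : Fin n, r ^ (i : ℕ)) * (τ - 1) - τ ^ n = constE r n) ∧
    0 < constE r n := by
  obtain ⟨m, rfl⟩ : ∃ m, n = m + 1 := ⟨n - 1, by omega⟩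
  have hm : m ≠ 0 := by omega
  set S := ∑ i : Fin (m + 1), r ^ (i : ℕ) with hS
  have hr1 : r - 1 ≠ 0 := by linarith
  have hSgeom : S = (r ^ (m + 1) - 1) / (r - 1) := by
    rw [hS, Fin.sum_univ_eq_sum_range (fun i => r ^ i), geom_sum_eq hr.ne']
  have hM : (0 : ℝ) < (m : ℝ) + 1 := by positivity
  have hlow : (m + 1 : ℝ) ≤ S := by
    have := Finset.card_nsmul_le_sum (Finset.univ : Finset (Fin (m + 1)))
      (fun i => r ^ (i : ℕ)) 1 fun i _ => one_le_pow₀ hr.le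
    simpa using this
  have hup : S ≤ (m + 1 : ℝ) * r ^ m := by
    have := Finset.sum_le_card_nsmul (Finset.univ : Finset (Fin (m + 1)))
      (fun i => r ^ (i : ℕ)) (r ^ m) fun i _ => pow_le_pow_right₀ hr.le (by omega)
    simpa using this
  set τ := (S / (m + 1)) ^ ((m : ℝ)⁻¹) with hτ
  have hq : 0 ≤ S / (m + 1) := by positivity
  have hτ0 : 0 ≤ τ := Real.rpow_nonneg hq _
  have hτm : τ ^ m = S / (m + 1) := Real.rpow_inv_natCast_pow hq hm
  have hτ1 : 1 ≤ τ := by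
    refine le_of_pow_le_pow_left₀ hm hτ0 ?_
    rw [hτm, one_pow, le_div_iff₀ hM]; linarith
  have hτr : τ ≤ r := by
    refine le_of_pow_le_pow_left₀ hm (by linarith) ?_
    rw [hτm, div_le_iff₀ hM]; linarith
  have hE : 1 + S * (τ - 1) - τ ^ (m + 1) = constE r (m + 1) := by
    have h1 : constE r (m + 1) = 1 + S * ((m : ℝ) / (m + 1) * τ - 1) := by
      rw [constE, hτ, hSgeom]
      push_cast
      rw [add_sub_cancel_right, one_div, div_div, mul_comm ((m : ℝ) + 1) (r - 1)]
    rw [h1, pow_succ, hτm]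
    field_simp
    ring
  have hle : ∀ t : ℝ, 0 ≤ t → 1 + S * (t - 1) - t ^ (m + 1) ≤ constE r (m + 1) := by
    intro t ht
    have hb := one_add_mul_sub_le_pow (a := t / τ) (by
      have : 0 ≤ t / τ := by positivity
      linarith) (m + 1)
    have hτp : 0 < τ := by linarith
    have h2 : (1 + ((m + 1 : ℕ) : ℝ) * (t / τ - 1)) * τ ^ (m + 1) ≤ t ^ (m + 1) := by
      have := mul_le_mul_of_nonneg_right hb (by positivity : 0 ≤ τ ^ (m + 1))
      rwa [div_pow, div_mul_cancel₀ _ (by positivity)] at this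
    have h3 : (1 + ((m + 1 : ℕ) : ℝ) * (t / τ - 1)) * τ ^ (m + 1)
        = τ ^ (m + 1) + S * (t - τ) := by
      have hS' : S = (m + 1) * τ ^ m := by rw [hτm]; field_simp
      rw [hS']
      push_cast
      field_simp
      ring
    rw [← hE]
    linarith
  refine ⟨hle, ⟨τ, hτ1, hτr, hE⟩, ?_⟩
  -- strict convexity of the power makes the objective positive at the midpoint of `[1, r]`
  have hmid := (strictConvexOn_pow hn).2 (show (1 : ℝ) ∈ Set.Ici 0 by simp)
    (show r ∈ Set.Ici (0 : ℝ) by simp; linarith) hr.ne (show (0 : ℝ) < 1 / 2 by norm_num)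
    (show (0 : ℝ) < 1 / 2 by norm_num) (by norm_num)
  have h4 := hle (1 / 2 * 1 + 1 / 2 * r) (by linarith)
  simp only [smul_eq_mul, one_pow] at hmid
  have h5 : S * (r - 1) = r ^ (m + 1) - 1 := by rw [hSgeom, div_mul_cancel₀ _ hr1]
  nlinarith

/-! ### The constant `D` -/

/-- The bound by `D` extends to `k = 0` and `k = n`, where the difference vanishes, because
`D > 0`. -/
theorem constD_props {n : ℕ} (hn : 2 ≤ n) {r : ℝ} (hr : 1 < r) :
    0 < constD r n hn ∧
    ∀ k ≤ n, (1 + (k : ℝ) / n * (r - 1)) ^ n - r ^ k ≤ constD r n hn := by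
  have hn0 : (0 : ℝ) < n := by positivity
  have hmem : ∀ k ∈ Finset.Icc 1 (n - 1),
      (1 + (k : ℝ) / n * (r - 1)) ^ n - r ^ k ≤ constD r n hn := fun k hk =>
    Finset.le_sup' (fun i : ℕ => (1 + (i : ℝ) / (n : ℝ) * (r - 1)) ^ n - r ^ i) hk
  have hpos : 0 < constD r n hn := by
    refine lt_of_lt_of_le ?_ (hmem 1 (by simp; omega))
    have := one_add_mul_self_lt_rpow_one_add (s := (r - 1) / n) (p := n)
      (by have : 0 ≤ (r - 1) / n := div_nonneg (by linarith) hn0.le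
          linarith)
      (div_ne_zero (by linarith) hn0.ne') (by exact_mod_cast hn)
    rw [Real.rpow_natCast, mul_div_cancel₀ _ hn0.ne'] at this
    have e : 1 + ((1 : ℕ) : ℝ) / n * (r - 1) = 1 + (r - 1) / n := by push_cast; ring
    rw [e, pow_one]
    linarith
  refine ⟨hpos, fun k hk => ?_⟩
  rcases Nat.eq_zero_or_pos k with rfl | hk0
  · simpa using hpos.le
  rcases hk.eq_or_lt with rfl | hlt
  · rw [div_self hn0.ne']
    simpa using hpos.le
  · exact hmem k (by simp; omega)

theorem constD_exists {n : ℕ} (hn : 2 ≤ n) (r : ℝ) :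
    ∃ k ≤ n, (1 + (k : ℝ) / n * (r - 1)) ^ n - r ^ k = constD r n hn := by
  obtain ⟨k, hk, h⟩ := Finset.exists_mem_eq_sup' (Finset.nonempty_Icc.mpr
    (Nat.le_sub_one_of_lt hn)) (fun i : ℕ => (1 + (i : ℝ) / (n : ℝ) * (r - 1)) ^ n - r ^ i)
  exact ⟨k, by simp at hk; omega, h.symm⟩

/-! ### Error bounds for points between the linear bounds -/

/-- If `w` lies below every linear overestimator obtained from `prod_le_one_add_sum_pow_mul` by
permuting the coordinates, then `w - ∏ xᵢ` is at most `E`, with equality only on the open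
diagonal. -/
theorem sub_prod_le_constE {n : ℕ} (hn : 2 ≤ n) {r : ℝ} (hr : 1 < r) {x : Fin n → ℝ} {w : ℝ}
    (hx : ∀ i, x i ∈ Set.Icc 1 r)
    (hw : ∀ σ : Equiv.Perm (Fin n), w ≤ 1 + ∑ i : Fin n, r ^ (i : ℕ) * (x (σ i) - 1)) :
    w - ∏ i, x i ≤ constE r n ∧
      (w - ∏ i, x i = constE r n → ∃ t, 1 < t ∧ t < r ∧ x = fun _ => t) := by
  obtain ⟨hE, -, hEpos⟩ := constE_isMax hn hr
  have hpos : ∀ i, 0 < x i := fun i => by linarith [(hx i).1]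
  have hP : 0 < ∏ i, x i := Finset.prod_pos fun i _ => hpos i
  set t := (∏ i, x i) ^ ((n : ℝ)⁻¹) with ht
  have htn : t ^ n = ∏ i, x i := Real.rpow_inv_natCast_pow hP.le (by omega)
  have ht0 : 0 < t := Real.rpow_pos_of_pos hP _
  -- the permutation sorting `x` in decreasing order gives the smallest overestimator
  set σ := Tuple.sort fun i => -x i with hσ
  have hanti : Antitone fun i => x (σ i) := fun i j hij => by
    have := Tuple.monotone_sort (fun i => -x i) hij
    simpa using this
  obtain ⟨h1, h2⟩ := sum_pow_mul_le_of_antitone hr.le ht0 (fun i => hx (σ i)) hanti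
    (by rw [htn]; exact Equiv.prod_comp σ x)
  have hsplit : ∑ i : Fin n, r ^ (i : ℕ) * (x (σ i) - 1)
      = ∑ i : Fin n, r ^ (i : ℕ) * x (σ i) - ∑ i : Fin n, r ^ (i : ℕ) := by
    simp only [mul_sub, mul_one, Finset.sum_sub_distrib]
  have hwσ := hw σ
  rw [hsplit] at hwσ
  have hEt := hE t ht0.le
  rw [← htn]
  refine ⟨by linarith, fun heq => ?_⟩
  have hall : ∀ i, x i = t := fun i => by
    simpa using h2 (by linarith) (σ.symm i)
  have hxt : x = fun _ => t := funext hall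
  have hti : t ∈ Set.Icc 1 r := hall ⟨0, by omega⟩ ▸ hx ⟨0, by omega⟩
  have hw1 := hw 1
  rw [hxt, ← Finset.sum_mul] at hw1
  -- at both ends of the diagonal the overestimator is exact
  refine ⟨t, lt_of_le_of_ne hti.1 fun h => ?_, lt_of_le_of_ne hti.2 fun h => ?_, hxt⟩
  · rw [← h] at hw1 heq
    simp only [sub_self, mul_zero, one_pow] at hw1 heq
    linarith
  · rw [h] at hw1 heq
    rw [Fin.sum_univ_eq_sum_range (fun i => r ^ i), geom_sum_mul] at hw1
    linarith

/-- If `w` lies above every linear underestimator of `pow_mul_one_add_sum_sub_le_prod`, then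
`∏ xᵢ - w` is at most `D`, with equality only on the open diagonal. By the inequality of arithmetic
and geometric means it suffices to treat constant vectors; there the power is convex in the
coordinate sum while the largest underestimator interpolates linearly between the sums that occur
at vertices. -/
theorem prod_sub_le_constD {n : ℕ} (hn : 2 ≤ n) {r : ℝ} (hr : 1 < r) {x : Fin n → ℝ} {w : ℝ}
    (hx : ∀ i, x i ∈ Set.Icc 1 r)
    (hw : ∀ k : ℕ, r ^ k * (1 + ∑ i, (x i - 1) - k * (r - 1)) ≤ w) :
    ∏ i, x i - w ≤ constD r n hn ∧
      (∏ i, x i - w = constD r n hn → ∃ t, 1 < t ∧ t < r ∧ x = fun _ => t) := by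
  obtain ⟨hDpos, hD⟩ := constD_props hn hr
  have hpos : ∀ i, 0 < x i := fun i => by linarith [(hx i).1]
  have hr1 : 0 < r - 1 := by linarith
  have hn0 : (0 : ℝ) < n := by positivity
  set s := (∑ i, (x i - 1)) / (r - 1) with hs
  have hsum : ∑ i, (x i - 1) = s * (r - 1) := by rw [hs]; field_simp
  have hs0 : 0 ≤ s := div_nonneg (Finset.sum_nonneg fun i _ => by linarith [(hx i).1]) hr1.le
  have hsn : s ≤ n := by
    rw [hs, div_le_iff₀ hr1]
    have := Finset.sum_le_card_nsmul Finset.univ (fun i => x i - 1) (r - 1)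
      fun i _ => by linarith [(hx i).2]
    simpa using this
  obtain ⟨k, hkn, hks, hsk⟩ : ∃ k : ℕ, k + 1 ≤ n ∧ (k : ℝ) ≤ s ∧ s ≤ k + 1 := by
    rcases hs0.eq_or_lt with h0 | h0
    · exact ⟨0, by omega, by simp [← h0], by rw [← h0]; simp⟩
    · have hc : 0 < ⌈s⌉₊ := Nat.ceil_pos.2 h0
      have hcn : ⌈s⌉₊ ≤ n := Nat.ceil_le.2 hsn
      have h1 := Nat.ceil_lt_add_one hs0
      have h2 := Nat.le_ceil s
      refine ⟨⌈s⌉₊ - 1, by omega, ?_, ?_⟩ <;> push_cast [Nat.cast_sub (Nat.succ_le_of_lt hc)] <;>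
        linarith
  set a := 1 + s / n * (r - 1) with ha
  have ha1 : 1 ≤ a := by
    have : 0 ≤ s / n * (r - 1) := by positivity
    linarith
  have hmean : ∑ i, x i = n * a := by
    have h : ∑ i, (x i - 1) = ∑ i, x i - n := by simp
    rw [ha, mul_add, ← mul_assoc, mul_div_cancel₀ _ hn0.ne']
    linarith
  obtain ⟨hle, heq⟩ := prod_le_pow_of_sum_eq (by linarith) hpos hmean
  have hconv : a ^ n ≤ (k + 1 - s) * (1 + (k : ℝ) / n * (r - 1)) ^ n
      + (s - k) * (1 + ((k + 1 : ℕ) : ℝ) / n * (r - 1)) ^ n := by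
    have hmem : ∀ j : ℕ, 1 + (j : ℝ) / n * (r - 1) ∈ Set.Ici (0 : ℝ) := fun j => by
      have : 0 ≤ (j : ℝ) / n * (r - 1) := by positivity
      simp only [Set.mem_Ici]; linarith
    have h := (convexOn_pow n).2 (hmem k) (hmem (k + 1)) (show 0 ≤ (k : ℝ) + 1 - s by linarith)
      (show 0 ≤ s - k by linarith) (by ring)
    simp only [smul_eq_mul] at h
    have e : a = (k + 1 - s) * (1 + (k : ℝ) / n * (r - 1))
        + (s - k) * (1 + ((k + 1 : ℕ) : ℝ) / n * (r - 1)) := by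
      rw [ha]; push_cast; field_simp; ring
    rwa [← e] at h
  have hd1 := hD k (by omega)
  have hd2 := hD (k + 1) hkn
  have hwk := hw k
  rw [hsum] at hwk
  have hlin : r ^ k * (1 + s * (r - 1) - k * (r - 1))
      = (k + 1 - s) * r ^ k + (s - k) * r ^ (k + 1) := by ring
  rw [hlin] at hwk
  have hub : a ^ n - w ≤ constD r n hn := by
    nlinarith [mul_le_mul_of_nonneg_left hd1 (show 0 ≤ (k : ℝ) + 1 - s by linarith),
      mul_le_mul_of_nonneg_left hd2 (show 0 ≤ s - k by linarith)]
  refine ⟨by linarith, fun h => ?_⟩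
  have hall := heq (by linarith)
  have hxa : x = fun _ => a := funext hall
  have hai : a ∈ Set.Icc 1 r := hall ⟨0, by omega⟩ ▸ hx ⟨0, by omega⟩
  -- at both ends of the diagonal one of the underestimators is exact
  refine ⟨a, lt_of_le_of_ne hai.1 fun h1 => ?_, lt_of_le_of_ne hai.2 fun h1 => ?_, hxa⟩
  · have := hw 0
    rw [hxa, ← h1] at this h
    simp at this h
    linarith
  · have := hw n
    rw [hxa, h1] at this h
    simp at this h
    linarith

/-! ### Extremal points of the hull of the graph -/

theorem mem_oneBox {n : ℕ} {r : ℝ} {x : Fin n → ℝ} :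
    x ∈ oneBox r n ↔ ∀ i, x i ∈ Set.Icc 1 r := by
  simp only [oneBox, Set.mem_Icc, Pi.le_def, forall_and]

theorem convex_oneBox (r : ℝ) (n : ℕ) : Convex ℝ (oneBox r n) := convex_Icc _ _

/-- The point `t𝟏` of the chord of the graph over the diagonal at which the deviation is `E`. -/
theorem exists_mem_hull_sub_eq_constE {n : ℕ} (hn : 2 ≤ n) {r : ℝ} (hr : 1 < r) :
    ∃ x w, (x, w) ∈ convexHull ℝ (Set.graphOn (multilinearMonomial n) (oneBox r n)) ∧
      w - multilinearMonomial n x = constE r n := by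
  obtain ⟨-, ⟨t, h1, h2, h3⟩, -⟩ := constE_isMax hn hr
  have hr1 : 0 < r - 1 := by linarith
  refine ⟨fun _ => t, 1 + (∑ i : Fin n, r ^ (i : ℕ)) * (t - 1), ?_, by
    simpa [multilinearMonomial] using h3⟩
  have hm : ∀ y ∈ Set.Icc 1 r, ((fun _ => y : Fin n → ℝ), y ^ n) ∈
      convexHull ℝ (Set.graphOn (multilinearMonomial n) (oneBox r n)) := fun y hy =>
    subset_convexHull ℝ _ (by
      rw [Set.mem_graphOn]
      exact ⟨mem_oneBox.2 fun _ => hy, by simp [multilinearMonomial]⟩)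
  have h := convex_convexHull ℝ (Set.graphOn (multilinearMonomial n) (oneBox r n))
    (hm 1 ⟨le_rfl, hr.le⟩) (hm r ⟨hr.le, le_rfl⟩)
    (show 0 ≤ (r - t) / (r - 1) from div_nonneg (by linarith) hr1.le)
    (show 0 ≤ (t - 1) / (r - 1) from div_nonneg (by linarith) hr1.le)
    (by field_simp; ring)
  convert h using 1
  rw [Fin.sum_univ_eq_sum_range (fun i => r ^ i), geom_sum_eq hr.ne']
  ext
  · simp only [Prod.smul_mk, Prod.mk_add_mk, Pi.add_apply, Pi.smul_apply, smul_eq_mul]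
    field_simp; ring
  · simp only [Prod.smul_mk, Prod.mk_add_mk, smul_eq_mul, one_pow]
    field_simp; ring

theorem card_fin_filter_lt {n k : ℕ} (hk : k ≤ n) :
    (Finset.univ.filter fun j : Fin n => (j : ℕ) < k).card = k := by
  rw [Fin.card_filter_val_lt, min_eq_right hk]

/-- The average of the `n` cyclic shifts of the vertex `(r, …, r, 1, …, 1)` with `k` entries `r` is
a point of the diagonal; the average of the graph over them has height `r ^ k`. -/
theorem exists_mem_hull_sub_eq_constD {n : ℕ} (hn : 2 ≤ n) {r : ℝ} (hr : 1 < r) :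
    ∃ x w, (x, w) ∈ convexHull ℝ (Set.graphOn (multilinearMonomial n) (oneBox r n)) ∧
      multilinearMonomial n x - w = constD r n hn := by
  obtain ⟨k, hk, hD⟩ := constD_exists hn r
  have hn0 : (0 : ℝ) < n := by positivity
  have : NeZero n := ⟨by omega⟩
  refine ⟨fun _ => 1 + (k : ℝ) / n * (r - 1), r ^ k, ?_, by
    simpa [multilinearMonomial] using hD⟩
  set v : Fin n → Fin n → ℝ := fun c j => if ((j - c : Fin n) : ℕ) < k then r else 1 with hv
  have hvf : ∀ c, multilinearMonomial n (v c) = r ^ k := fun c => by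
    have e := Equiv.prod_comp (Equiv.subRight c) fun j : Fin n => if (j : ℕ) < k then r else 1
    refine e.trans ?_
    rw [Finset.prod_ite, Finset.prod_const, Finset.prod_const_one, mul_one, card_fin_filter_lt hk]
  have hvs : ∀ j, ∑ c, v c j = n + k * (r - 1) := fun j => by
    have e := Equiv.sum_comp (Equiv.subLeft j) fun c : Fin n => if (c : ℕ) < k then r else 1
    refine e.trans ?_
    have : ∀ c : Fin n, (if (c : ℕ) < k then r else (1 : ℝ))
        = 1 + if (c : ℕ) < k then r - 1 else 0 := fun c => by split_ifs <;> ring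
    simp only [this, Finset.sum_add_distrib, ← Finset.sum_filter, Finset.sum_const,
      card_fin_filter_lt hk]
    simp
  have h := (convex_convexHull ℝ (Set.graphOn (multilinearMonomial n) (oneBox r n))).sum_mem
    (t := Finset.univ) (w := fun _ : Fin n => (1 : ℝ) / n)
    (z := fun c => (v c, multilinearMonomial n (v c))) (fun _ _ => by positivity)
    (by simp [hn0.ne']) fun c _ => subset_convexHull ℝ _ (by
      rw [Set.mem_graphOn]
      refine ⟨mem_oneBox.2 fun j => ?_, rfl⟩
      rw [hv]
      dsimp only
      split_ifs
      exacts [⟨hr.le, le_rfl⟩, ⟨le_rfl, hr.le⟩])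
  convert h using 1
  ext j
  · simp only [Prod.fst_sum, Finset.sum_apply, Prod.smul_mk, Pi.smul_apply, smul_eq_mul,
      ← Finset.mul_sum, hvs]
    field_simp
  · simp only [Prod.snd_sum, Prod.smul_mk, smul_eq_mul, hvf]
    simp [hn0.ne']

/-! ### Envelopes and the hull lie between the linear bounds -/

theorem convexOn_and_concaveOn_affine {n : ℕ} {B : Set (Fin n → ℝ)} (hB : Convex ℝ B) (c : ℝ)
    (α : Fin n → ℝ) (σ : Equiv.Perm (Fin n)) :
    ConvexOn ℝ B (fun x => c + ∑ i, α i * (x (σ i) - 1)) ∧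
      ConcaveOn ℝ B (fun x => c + ∑ i, α i * (x (σ i) - 1)) := by
  have key : ∀ (x y : Fin n → ℝ) (a b : ℝ), a + b = 1 →
      c + ∑ i, α i * ((a • x + b • y) (σ i) - 1)
        = a • (c + ∑ i, α i * (x (σ i) - 1)) + b • (c + ∑ i, α i * (y (σ i) - 1)) := by
    intro x y a b hab
    obtain rfl : b = 1 - a := by linarith
    have : ∑ i, α i * ((a • x + (1 - a) • y) (σ i) - 1)
        = a * ∑ i, α i * (x (σ i) - 1) + (1 - a) * ∑ i, α i * (y (σ i) - 1) := by
      rw [Finset.mul_sum, Finset.mul_sum, ← Finset.sum_add_distrib]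
      refine Finset.sum_congr rfl fun i _ => ?_
      simp only [Pi.add_apply, Pi.smul_apply, smul_eq_mul]
      ring
    rw [this, smul_eq_mul, smul_eq_mul]
    ring
  exact ⟨⟨hB, fun x _ y _ a b _ _ hab => (key x y a b hab).le⟩,
    ⟨hB, fun x _ y _ a b _ _ hab => (key x y a b hab).ge⟩⟩

theorem concaveOn_overestimator {n : ℕ} (r : ℝ) (σ : Equiv.Perm (Fin n)) :
    ConcaveOn ℝ (oneBox r n) fun x => 1 + ∑ i : Fin n, r ^ (i : ℕ) * (x (σ i) - 1) :=
  (convexOn_and_concaveOn_affine (convex_oneBox r n) 1 (fun i => r ^ (i : ℕ)) σ).2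

theorem multilinearMonomial_le_overestimator {n : ℕ} {r : ℝ} (hr : 1 ≤ r)
    (σ : Equiv.Perm (Fin n)) {x : Fin n → ℝ} (hx : x ∈ oneBox r n) :
    multilinearMonomial n x ≤ 1 + ∑ i : Fin n, r ^ (i : ℕ) * (x (σ i) - 1) := by
  rw [multilinearMonomial, ← Equiv.prod_comp σ x]
  exact prod_le_one_add_sum_pow_mul hr n (fun i => x (σ i)) fun i => mem_oneBox.1 hx _

theorem convexOn_underestimator {n : ℕ} (r : ℝ) (k : ℕ) :
    ConvexOn ℝ (oneBox r n) fun x => r ^ k * (1 + ∑ i, (x i - 1) - k * (r - 1)) := by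
  have := (convexOn_and_concaveOn_affine (convex_oneBox r n) (r ^ k * (1 - k * (r - 1)))
    (fun _ => r ^ k) 1).1
  convert this using 2
  rw [← Finset.mul_sum]
  simp only [Equiv.Perm.coe_one, id_eq]
  ring

theorem underestimator_le_multilinearMonomial {n : ℕ} {r : ℝ} (hr : 1 ≤ r) (k : ℕ)
    {x : Fin n → ℝ} (hx : x ∈ oneBox r n) :
    r ^ k * (1 + ∑ i, (x i - 1) - k * (r - 1)) ≤ multilinearMonomial n x :=
  pow_mul_one_add_sum_sub_le_prod hr (mem_oneBox.1 hx) Finset.univ k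

theorem le_of_mem_convexHull_graphOn {E : Type*} [AddCommGroup E] [Module ℝ E] {B : Set E}
    {f g : E → ℝ} (hg : ConcaveOn ℝ B g) (hfg : ∀ y ∈ B, f y ≤ g y) {x : E} {w : ℝ}
    (h : (x, w) ∈ convexHull ℝ (Set.graphOn f B)) : x ∈ B ∧ w ≤ g x := by
  refine convexHull_min ?_ hg.convex_hypograph h
  rintro _ ⟨y, hy, rfl⟩
  exact ⟨hy, hfg y hy⟩

theorem ge_of_mem_convexHull_graphOn {E : Type*} [AddCommGroup E] [Module ℝ E] {B : Set E}
    {f g : E → ℝ} (hg : ConvexOn ℝ B g) (hfg : ∀ y ∈ B, g y ≤ f y) {x : E} {w : ℝ}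
    (h : (x, w) ∈ convexHull ℝ (Set.graphOn f B)) : x ∈ B ∧ g x ≤ w := by
  refine convexHull_min ?_ hg.convex_epigraph h
  rintro _ ⟨y, hy, rfl⟩
  exact ⟨hy, hfg y hy⟩

section Envelope

variable {n : ℕ} {f g : (Fin n → ℝ) → ℝ} {B : Set (Fin n → ℝ)} {x : Fin n → ℝ} {w : ℝ}

theorem concaveEnvelope_le (hg : ConcaveOn ℝ B g) (hfg : ∀ y ∈ B, f y ≤ g y) (hx : x ∈ B) :
    concaveEnvelope f B x ≤ g x :=
  csInf_le ⟨f x, by rintro _ ⟨h, -, hh, rfl⟩; exact hh x hx⟩ ⟨g, hg, hfg, rfl⟩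

/-- The hypothesis on `g` makes sure that the infimum is over a nonempty set. -/
theorem le_concaveEnvelope_of_mem_hull (hg : ConcaveOn ℝ B g) (hfg : ∀ y ∈ B, f y ≤ g y)
    (h : (x, w) ∈ convexHull ℝ (Set.graphOn f B)) : w ≤ concaveEnvelope f B x := by
  refine le_csInf ⟨g x, g, hg, hfg, rfl⟩ ?_
  rintro _ ⟨u, hu, hfu, rfl⟩
  exact (le_of_mem_convexHull_graphOn hu hfu h).2

theorem le_convexEnvelope (hg : ConvexOn ℝ B g) (hfg : ∀ y ∈ B, g y ≤ f y) (hx : x ∈ B) :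
    g x ≤ convexEnvelope f B x :=
  le_csSup ⟨f x, by rintro _ ⟨h, -, hh, rfl⟩; exact hh x hx⟩ ⟨g, hg, hfg, rfl⟩

/-- The hypothesis on `g` makes sure that the supremum is over a nonempty set. -/
theorem convexEnvelope_le_of_mem_hull (hg : ConvexOn ℝ B g) (hfg : ∀ y ∈ B, g y ≤ f y)
    (h : (x, w) ∈ convexHull ℝ (Set.graphOn f B)) : convexEnvelope f B x ≤ w := by
  refine csSup_le ⟨g x, g, hg, hfg, rfl⟩ ?_
  rintro _ ⟨u, hu, hfu, rfl⟩
  exact (ge_of_mem_convexHull_graphOn hu hfu h).2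

end Envelope

/-! ### The open diagonal -/

theorem const_mem_relintHull {n : ℕ} (hn : 0 < n) {r t : ℝ} (h1 : 1 < t) (h2 : t < r) :
    (fun _ => t : Fin n → ℝ) ∈ relintHull {(fun _ => 1 : Fin n → ℝ), (fun _ => r)} := by
  have hr1 : 0 < r - 1 := by linarith
  -- every point of the affine span whose first coordinate lies in `(1, r)` is in the segment
  have hseg : ∀ y ∈ affineSpan ℝ {(fun _ => 1 : Fin n → ℝ), (fun _ => r)},
      1 < y ⟨0, hn⟩ → y ⟨0, hn⟩ < r →
        y ∈ convexHull ℝ {(fun _ => 1 : Fin n → ℝ), (fun _ => r)} := by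
    intro y hy hy1 hy2
    obtain ⟨c, rfl⟩ := mem_affineSpan_pair_iff_exists_lineMap_eq.1 hy
    simp only [AffineMap.lineMap_apply, vsub_eq_sub, vadd_eq_add, Pi.add_apply, Pi.smul_apply,
      Pi.sub_apply, smul_eq_mul] at hy1 hy2
    rw [convexHull_pair, segment_eq_image_lineMap]
    exact ⟨c, ⟨by nlinarith, by nlinarith⟩, rfl⟩
  have hmem : (fun _ => t : Fin n → ℝ) ∈
      affineSpan ℝ {(fun _ => 1 : Fin n → ℝ), (fun _ => r)} := by
    refine mem_affineSpan_pair_iff_exists_lineMap_eq.2 ⟨(t - 1) / (r - 1), ?_⟩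
    ext j
    simp only [AffineMap.lineMap_apply, vsub_eq_sub, vadd_eq_add, Pi.add_apply, Pi.smul_apply,
      Pi.sub_apply, smul_eq_mul]
    field_simp
    ring
  rw [relintHull, mem_intrinsicInterior]
  refine ⟨⟨_, by rwa [affineSpan_convexHull]⟩, ?_, rfl⟩
  rw [mem_interior]
  refine ⟨{y | 1 < y.1 ⟨0, hn⟩ ∧ y.1 ⟨0, hn⟩ < r}, ?_, ?_, ⟨h1, h2⟩⟩
  · rintro ⟨y, hy⟩ ⟨hy1, hy2⟩
    rw [affineSpan_convexHull] at hy
    exact hseg y hy hy1 hy2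
  · have hc : Continuous fun y : affineSpan ℝ
        (convexHull ℝ {(fun _ => 1 : Fin n → ℝ), (fun _ => r)}) => y.1 ⟨0, hn⟩ :=
      (continuous_apply _).comp continuous_subtype_val
    exact (isOpen_lt continuous_const hc).inter (isOpen_lt hc continuous_const)

theorem mainTheorem5 (n : ℕ) (hn : 2 ≤ n) (r : ℝ) (hr : 1 < r) :
    let f := multilinearMonomial n
    let B := oneBox r n
    let cavGraph := Set.graphOn (concaveEnvelope f B) B
    let vexGraph := Set.graphOn (convexEnvelope f B) B
    let hull := convexHull ℝ (Set.graphOn f B)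
    let diag := relintHull {(fun _ => 1 : Fin n → ℝ), (fun _ => r)}
    (IsError f cavGraph (constE r n) ∧
      IsError f vexGraph (constD r n hn) ∧
      IsError f hull (max (constD r n hn) (constE r n))) ∧
    (AttainedOnlyOn f cavGraph (constE r n) diag ∧
      AttainedOnlyOn f vexGraph (constD r n hn) diag ∧
      AttainedOnlyOn f hull (max (constD r n hn) (constE r n)) diag) := by
  intro f B cavGraph vexGraph hull diag
  have hr' := hr.le
  have hgraph : ∀ x ∈ B, (x, f x) ∈ hull := fun x hx =>
    subset_convexHull ℝ _ (by rw [Set.mem_graphOn]; exact ⟨hx, rfl⟩)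
  have hover := fun σ => fun y hy => multilinearMonomial_le_overestimator (n := n) hr' σ (x := y) hy
  have hunder := fun k => fun y hy =>
    underestimator_le_multilinearMonomial (n := n) hr' k (x := y) hy
  have hdiag : ∀ x : Fin n → ℝ, (∃ t, 1 < t ∧ t < r ∧ x = fun _ => t) → x ∈ diag := by
    rintro x ⟨t, h1, h2, rfl⟩
    exact const_mem_relintHull (by omega) h1 h2
  have hcav : ∀ x ∈ B, f x ≤ concaveEnvelope f B x ∧
      concaveEnvelope f B x - f x ≤ constE r n ∧
      (concaveEnvelope f B x - f x = constE r n → x ∈ diag) := fun x hx => by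
    obtain ⟨h1, h2⟩ := sub_prod_le_constE hn hr (mem_oneBox.1 hx) fun σ =>
      concaveEnvelope_le (concaveOn_overestimator r σ) (hover σ) hx
    exact ⟨le_concaveEnvelope_of_mem_hull (concaveOn_overestimator r 1) (hover 1) (hgraph x hx),
      h1, fun h => hdiag x (h2 h)⟩
  have hvex : ∀ x ∈ B, convexEnvelope f B x ≤ f x ∧
      f x - convexEnvelope f B x ≤ constD r n hn ∧
      (f x - convexEnvelope f B x = constD r n hn → x ∈ diag) := fun x hx => by
    obtain ⟨h1, h2⟩ := prod_sub_le_constD hn hr (mem_oneBox.1 hx) fun k =>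
      le_convexEnvelope (convexOn_underestimator r k) (hunder k) hx
    exact ⟨convexEnvelope_le_of_mem_hull (convexOn_underestimator r 0) (hunder 0) (hgraph x hx),
      h1, fun h => hdiag x (h2 h)⟩
  have hhull : ∀ x w, (x, w) ∈ hull → x ∈ B ∧
      w ≤ concaveEnvelope f B x ∧ convexEnvelope f B x ≤ w := fun x w h =>
    ⟨(le_of_mem_convexHull_graphOn (concaveOn_overestimator r 1) (hover 1) h).1,
      le_concaveEnvelope_of_mem_hull (concaveOn_overestimator r 1) (hover 1) h,
      convexEnvelope_le_of_mem_hull (convexOn_underestimator r 0) (hunder 0) h⟩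
  obtain ⟨xE, wE, hEmem, hE⟩ := exists_mem_hull_sub_eq_constE hn hr
  obtain ⟨xD, wD, hDmem, hD⟩ := exists_mem_hull_sub_eq_constD hn hr
  obtain ⟨hxE, hwE, -⟩ := hhull _ _ hEmem
  obtain ⟨hxD, -, hwD⟩ := hhull _ _ hDmem
  have hEpos := (constE_isMax hn hr).2.2
  have hDpos := (constD_props hn hr).1
  have hhull_le : ∀ x w, (x, w) ∈ hull → |w - f x| ≤ max (constD r n hn) (constE r n) := by
    intro x w h
    obtain ⟨hx, h1, h2⟩ := hhull x w h
    rw [abs_le]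
    constructor
    · linarith [(hvex x hx).2.1, le_max_left (constD r n hn) (constE r n)]
    · linarith [(hcav x hx).2.1, le_max_right (constD r n hn) (constE r n)]
  refine ⟨⟨⟨⟨(xE, concaveEnvelope f B xE), ⟨xE, hxE, rfl⟩, ?_⟩, ?_⟩,
    ⟨⟨(xD, convexEnvelope f B xD), ⟨xD, hxD, rfl⟩, ?_⟩, ?_⟩, ⟨?_, ?_⟩⟩, ?_, ?_, ?_⟩
  · obtain ⟨h1, h2, -⟩ := hcav xE hxE
    rw [deviation, abs_of_nonneg (sub_nonneg.2 h1)]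
    exact le_antisymm h2 (hE ▸ sub_le_sub_right hwE _)
  · rintro _ ⟨_, ⟨x, hx, rfl⟩, rfl⟩
    obtain ⟨h1, h2, -⟩ := hcav x hx
    rwa [deviation, abs_of_nonneg (sub_nonneg.2 h1)]
  · obtain ⟨h1, h2, -⟩ := hvex xD hxD
    rw [deviation, abs_sub_comm, abs_of_nonneg (sub_nonneg.2 h1)]
    exact le_antisymm h2 (hD ▸ sub_le_sub_left hwD _)
  · rintro _ ⟨_, ⟨x, hx, rfl⟩, rfl⟩
    obtain ⟨h1, h2, -⟩ := hvex x hx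
    rwa [deviation, abs_sub_comm, abs_of_nonneg (sub_nonneg.2 h1)]
  · rcases max_choice (constD r n hn) (constE r n) with h | h <;> rw [h]
    · refine ⟨_, hDmem, ?_⟩
      rw [deviation, abs_sub_comm]
      exact (congrArg abs hD).trans (abs_of_pos hDpos)
    · exact ⟨_, hEmem, (congrArg abs hE).trans (abs_of_pos hEpos)⟩
  · rintro _ ⟨⟨x, w⟩, h, rfl⟩
    exact hhull_le x w h
  · rintro _ ⟨x, hx, rfl⟩ h
    obtain ⟨h1, -, h3⟩ := hcav x hx
    rw [deviation, abs_of_nonneg (sub_nonneg.2 h1)] at h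
    exact h3 h
  · rintro _ ⟨x, hx, rfl⟩ h
    obtain ⟨h1, -, h3⟩ := hvex x hx
    rw [deviation, abs_sub_comm, abs_of_nonneg (sub_nonneg.2 h1)] at h
    exact h3 h
  · rintro ⟨x, w⟩ hmem h
    obtain ⟨hx, h1, h2⟩ := hhull x w hmem
    obtain ⟨-, hc2, hc3⟩ := hcav x hx
    obtain ⟨-, hv2, hv3⟩ := hvex x hx
    have hmD := le_max_left (constD r n hn) (constE r n)
    have hmE := le_max_right (constD r n hn) (constE r n)
    -- the sign of the deviation decides which envelope is tight
    change |w - f x| = _ at h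
    rcases le_total 0 (w - f x) with h0 | h0
    · rw [abs_of_nonneg h0] at h
      exact hc3 (le_antisymm hc2 (by linarith))
    · rw [abs_of_nonpos h0] at h
      exact hv3 (le_antisymm hv2 (by linarith))
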